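/- A weak near-unanimity (wnu) operation on a set $A$ is an operation $w\colon A^k\to A$ of arity $k\ge 2$ that is idempotent, $w(x,\dots,x)=x$, and satisfies $w(y,x,\dots,x)=w(x,y,x,\dots,x)=\dots=w(x,\dots,x,y)$ for all $x,y\in A$. A wnu algebra is an algebra $\mathbf A=\langle A;w\rangle$ whose only fundamental operation $w$ is a wnu operation. **Proposition.** Let $\mathbf A=\langle A;w\rangle$ be any finite (nonempty) wnu algebra. Then there exists a finite simple algebra $\mathbf B=\langle B;v\rangle$ of type $\mathbf 5$ such that $v$ is a weak near-unanimity operation on $B$ of the same arity as $w$ and $\mathbf A$ is (up to isomorphism) a subalgebra of $\mathbf B$, i.e. there is an injective map $\iota\colon A\to B$ with $\iota(w(x_1,\dots,x_k))=v(\iota(x_1),\dots,\iota(x_k))$ for all $x_1,\dots,x_k\in A$. Here "simple of type $\mathbf 5$" means that $\mathbf B$ has exactly two congruences, $0_B\ne 1_B$, and that $\mathrm{typ}(0_B,1_B)=\mathbf 5$ in the sense of tame congruence theory: the polynomial operations of $\mathbf B$ that preserve a $(0_B,1_B)$-trace $N$, restricted to $N$, form an algebra polynomially equivalent to a two-element semilattice.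 -/

import Mathlib

/-! Algebras `⟨A; w⟩` with a single fundamental operation `w` of arity `k`, their congruences and
polynomial operations, and type **5** of a covering pair of congruences (tame congruence theory). -/

universe u

/-- `w` is a weak near-unanimity operation: it has arity at least two, it is idempotent, and
`w(y,x,…,x) = w(x,y,x,…,x) = ⋯ = w(x,…,x,y)` for all `x`, `y`. -/
def IsWNU {A : Type*} {k : ℕ} (w : (Fin k → A) → A) : Prop :=
  2 ≤ k ∧ (∀ x : A, w (fun _ => x) = x) ∧
    ∀ (x y : A) (i j : Fin k),
      w (Function.update (fun _ => x) i y) = w (Function.update (fun _ => x) j y)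

/-- The `n`-ary polynomial operations of `⟨A; w⟩`: the smallest set of `n`-ary operations which
contains the constants and the projections and is closed under application of `w`. -/
inductive IsPolynomial {A : Type*} {k : ℕ} (w : (Fin k → A) → A) {n : ℕ} :
    ((Fin n → A) → A) → Prop
  | const (c : A) : IsPolynomial w (fun _ => c)
  | proj (i : Fin n) : IsPolynomial w (fun x => x i)
  | app (p : Fin k → (Fin n → A) → A) (hp : ∀ i, IsPolynomial w (p i)) :
      IsPolynomial w (fun x => w (fun i => p i x))

/-- An equivalence relation compatible with `w`. -/
def IsCongruence {A : Type*} {k : ℕ} (w : (Fin k → A) → A) (θ : Setoid A) : Prop :=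
  ∀ x y : Fin k → A, (∀ i, θ (x i) (y i)) → θ (w x) (w y)

/-- The congruences of `⟨A; w⟩`, ordered by inclusion. -/
abbrev Congruence {A : Type*} {k : ℕ} (w : (Fin k → A) → A) : Type _ :=
  {θ : Setoid A // IsCongruence w θ}

/-- The least congruence is equality and the largest one is the full relation. -/
instance Congruence.instBoundedOrder {A : Type*} {k : ℕ} (w : (Fin k → A) → A) :
    BoundedOrder (Congruence w) where
  top := ⟨⊤, fun _ _ _ => trivial⟩
  le_top θ := (le_top : θ.1 ≤ ⊤)
  bot := ⟨⊥, fun _ _ h => congrArg w (funext h)⟩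
  bot_le θ := (bot_le : ⊥ ≤ θ.1)

/-- `⟨A; w⟩` is simple: it has exactly two congruences, `0_A ≠ 1_A`. -/
def IsSimpleAlgebra {A : Type*} {k : ℕ} (w : (Fin k → A) → A) : Prop :=
  IsSimpleOrder (Congruence w)

/-- `U` is an `(α,β)`-minimal set: it is minimal under inclusion among the ranges `f(A)` of the
unary polynomial operations `f` of `⟨A; w⟩` with `f(β) ⊄ α`. -/
def IsMinimalSet {A : Type*} {k : ℕ} (w : (Fin k → A) → A) (α β : Congruence w)
    (U : Set A) : Prop :=
  Minimal (fun S : Set A => ∃ f : A → A,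
    IsPolynomial w (fun x : Fin 1 → A => f (x 0)) ∧
    (∃ x y : A, β.1 x y ∧ ¬ α.1 (f x) (f y)) ∧ S = Set.range f) U

/-- `N` is an `(α,β)`-trace: the intersection of an `(α,β)`-minimal set with a `β`-class, which is
not contained in one `α`-class. -/
def IsTrace {A : Type*} {k : ℕ} (w : (Fin k → A) → A) (α β : Congruence w)
    (N : Set A) : Prop :=
  ∃ U : Set A, IsMinimalSet w α β U ∧ (∃ a : A, N = {x | x ∈ U ∧ β.1 a x}) ∧
    ∃ x ∈ N, ∃ y ∈ N, ¬ α.1 x y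

/-- The meet operation of the two-element semilattice. -/
def boolMeet : (Fin 2 → Bool) → Bool := fun x => x 0 && x 1

/-- The algebra `(A|_N)/(α|_N)` is polynomially equivalent to a two-element semilattice. Here `A|_N`
has as its operations all restrictions to `N` of polynomial operations of `⟨A; w⟩` which preserve
`N`; the map `φ` identifies `N/(α|_N)` with the universe of the semilattice `⟨Bool; ∧⟩`. -/
def InducesSemilattice {A : Type*} {k : ℕ} (w : (Fin k → A) → A) (α : Congruence w)
    (N : Set A) : Prop :=
  ∃ φ : N → Bool, Function.Surjective φ ∧ (∀ x y : N, φ x = φ y ↔ α.1 x y) ∧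
    ∀ (n : ℕ) (g : (Fin n → Bool) → Bool),
      IsPolynomial boolMeet g ↔
        ∃ p : (Fin n → A) → A, IsPolynomial w p ∧
          ∀ x : Fin n → N, ∃ h : p (fun i => (x i : A)) ∈ N,
            φ ⟨p (fun i => (x i : A)), h⟩ = g (fun i => φ (x i))

/-- `typ(α,β) = 5`: `β` covers `α` in the congruence lattice of `⟨A; w⟩`, and the algebra induced
on the `(α,β)`-traces modulo `α` is polynomially equivalent to a two-element semilattice. -/
def HasTypeFive {A : Type*} {k : ℕ} (w : (Fin k → A) → A) (α β : Congruence w) : Prop :=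
  α ⋖ β ∧ (∃ N : Set A, IsTrace w α β N) ∧
    ∀ N : Set A, IsTrace w α β N → InducesSemilattice w α N

/-! Every finite wnu algebra `⟨A; w⟩` embeds into a finite simple algebra of type **5**: adjoin an
absorbing element, a hub, and an arrow from every element of `A` to every element of `A` and to the
hub; translations by arrows move elements around and separate them. -/

/-! Outside `A` the new operation depends only on the set of entries and is zero unless that set has
at most two elements. There it is the commutative product `link`, so the wnu identities hold
automatically and `A` stays a subalgebra. Arrows make the polynomials rich: mapping one `base a` to
any chosen element and everything else to zero is polynomial (`exists_indicator`), and any nonzero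
element can be moved into `A` with zero fixed (`exists_to_base`). Hence every pair {zero, c} is a
polynomial retract, and any two distinct elements related by a congruence force it to be full.
Absorption gives the type: a polynomial vanishes once a variable of its term is zero, so on {zero,
c} only constants and meets occur, and retracting `op w` onto the pair yields the meet. -/

section Polynomials

/-! ### Polynomial operations and absorption -/

variable {A : Type*} {k : ℕ} {w : (Fin k → A) → A}

theorem IsPolynomial.comp {m n : ℕ} {q : (Fin m → A) → A} (hq : IsPolynomial w q)
    {p : Fin m → (Fin n → A) → A} (hp : ∀ i, IsPolynomial w (p i)) :
    IsPolynomial w (fun x => q (fun i => p i x)) := by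
  induction hq with
  | const c => exact .const c
  | proj i => exact hp i
  | app r _ ih => exact .app (fun i x => r i (fun j => p j x)) ih

/-- `f` is a unary polynomial operation of `⟨A; w⟩`. -/
def IsUnaryPolynomial (w : (Fin k → A) → A) (f : A → A) : Prop :=
  IsPolynomial w (fun x : Fin 1 → A => f (x 0))

theorem IsUnaryPolynomial.comp_polynomial {f : A → A} (hf : IsUnaryPolynomial w f) {n : ℕ}
    {p : (Fin n → A) → A} (hp : IsPolynomial w p) : IsPolynomial w (fun x => f (p x)) :=
  IsPolynomial.comp hf (p := fun _ => p) fun _ => hp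

theorem IsUnaryPolynomial.comp {f g : A → A} (hf : IsUnaryPolynomial w f)
    (hg : IsUnaryPolynomial w g) : IsUnaryPolynomial w (fun x => f (g x)) :=
  hf.comp_polynomial hg

theorem isUnaryPolynomial_id : IsUnaryPolynomial w (fun x => x) := .proj 0

theorem IsPolynomial.update {n : ℕ} {p q : (Fin n → A) → A} (hp : IsPolynomial w p)
    (hq : IsPolynomial w q) (i : Fin k) :
    IsPolynomial w (fun x => w (Function.update (fun _ => p x) i (q x))) := by
  have h : ∀ j, IsPolynomial w (fun x => Function.update (fun _ => p x) i (q x) j) := by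
    intro j
    by_cases hj : j = i
    · subst hj
      simpa using hq
    · simpa [Function.update_of_ne hj] using hp
  exact .app _ h

theorem isUnaryPolynomial_translation (i : Fin k) (u : A) :
    IsUnaryPolynomial w (fun x => w (Function.update (fun _ => u) i x)) :=
  IsPolynomial.update (.const u) (.proj 0) i

theorem IsUnaryPolynomial.congruence {f : A → A} (hf : IsUnaryPolynomial w f)
    (θ : Congruence w) {x y : A} (h : θ.1 x y) : θ.1 (f x) (f y) := by
  have key : ∀ p : (Fin 1 → A) → A, IsPolynomial w p → θ.1 (p fun _ => x) (p fun _ => y) := by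
    intro p hp
    induction hp with
    | const c => exact θ.1.refl c
    | proj i => exact h
    | app p _ ih => exact θ.2 _ _ ih
  exact key _ hf

/-- A polynomial operation depends only on the variables occurring in a term for it, and an
absorbing element substituted for any of these absorbs. -/
theorem IsPolynomial.exists_support {z : A} (hz : ∀ t : Fin k → A, (∃ i, t i = z) → w t = z)
    {n : ℕ} {p : (Fin n → A) → A} (hp : IsPolynomial w p) :
    ∃ S : Finset (Fin n), (∀ x y : Fin n → A, (∀ i ∈ S, x i = y i) → p x = p y) ∧
      ∀ x : Fin n → A, (∃ i ∈ S, x i = z) → p x = z := by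
  classical
  induction hp with
  | const c => exact ⟨∅, by simp, by simp⟩
  | proj i => exact ⟨{i}, by simp, by simp⟩
  | app p _ ih =>
    choose S h₁ h₂ using ih
    refine ⟨Finset.univ.biUnion S, fun x y h => ?_, fun x h => ?_⟩
    · refine congrArg w (funext fun i => h₁ i x y fun j hj => h j ?_)
      exact Finset.mem_biUnion.2 ⟨i, Finset.mem_univ i, hj⟩
    · obtain ⟨j, hj, hx⟩ := h
      obtain ⟨i, -, hi⟩ := Finset.mem_biUnion.1 hj
      exact hz _ ⟨i, h₂ i x ⟨j, hi, hx⟩⟩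

theorem IsUnaryPolynomial.map_absorbing {z : A}
    (hz : ∀ t : Fin k → A, (∃ i, t i = z) → w t = z) {f : A → A} (hf : IsUnaryPolynomial w f)
    {x y : A} (h : f x ≠ f y) : f z = z := by
  obtain ⟨S, h₁, h₂⟩ := IsPolynomial.exists_support hz hf
  rcases S.eq_empty_or_nonempty with rfl | ⟨i, hi⟩
  · exact absurd (h₁ (fun _ => x) (fun _ => y) (by simp)) h
  · exact h₂ (fun _ => z) ⟨i, hi, rfl⟩

/-- Together with constant false, these are the only operations that polynomials can induce on a
pair containing the absorbing element. -/
theorem isPolynomial_boolMeet_inf {n : ℕ} (S : Finset (Fin n)) :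
    IsPolynomial boolMeet (fun b : Fin n → Bool => decide (∀ i ∈ S, b i = true)) := by
  classical
  induction S using Finset.induction_on with
  | empty => simpa using IsPolynomial.const (w := boolMeet) (n := n) true
  | insert i S _ ih =>
    have h : ∀ j : Fin 2, IsPolynomial boolMeet
        (![fun b : Fin n → Bool => b i, fun b => decide (∀ i ∈ S, b i = true)] j) := by
      intro j
      fin_cases j
      · exact .proj i
      · exact ih
    convert IsPolynomial.app _ h using 2 with b
    simp [boolMeet]

end Polynomials

/-! ### A criterion for type 5 -/

section Criterion

variable {B : Type*} {k : ℕ} {v : (Fin k → B) → B} {z : B}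

/-- `e` is a unary polynomial operation of `⟨B; v⟩` and a retraction of `B` onto `{z, c}`. -/
def IsRetractionOntoPair (v : (Fin k → B) → B) (z c : B) (e : B → B) : Prop :=
  IsUnaryPolynomial v e ∧ e z = z ∧ e c = c ∧ ∀ x, e x = z ∨ e x = c

theorem IsRetractionOntoPair.range_eq {c : B} {e : B → B} (he : IsRetractionOntoPair v z c e) :
    Set.range e = {z, c} := by
  obtain ⟨-, h₁, h₂, h₃⟩ := he
  ext x
  constructor
  · rintro ⟨y, rfl⟩
    exact h₃ y
  · rintro (rfl | rfl)
    · exact ⟨_, h₁⟩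
    · exact ⟨_, h₂⟩

/-- A nonconstant unary polynomial fixes `z` and takes some value `c ≠ z`, so its range contains a
pair {z, c}, which is itself such a range. -/
theorem isMinimalSet_iff (hz : ∀ t : Fin k → B, (∃ i, t i = z) → v t = z)
    (hret : ∀ c, c ≠ z → ∃ e, IsRetractionOntoPair v z c e) (U : Set B) :
    IsMinimalSet v ⊥ ⊤ U ↔ ∃ c, c ≠ z ∧ U = {z, c} := by
  have mem : ∀ c, c ≠ z → ∃ f : B → B, IsPolynomial v (fun x : Fin 1 → B => f (x 0)) ∧
      (∃ x y : B, (⊤ : Congruence v).1 x y ∧ ¬ (⊥ : Congruence v).1 (f x) (f y)) ∧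
        ({z, c} : Set B) = Set.range f := by
    intro c hc
    obtain ⟨e, he⟩ := hret c hc
    refine ⟨e, he.1, ⟨c, z, trivial, fun h => hc ?_⟩, he.range_eq.symm⟩
    have h' : e c = e z := h
    rwa [he.2.1, he.2.2.1] at h'
  have sub : ∀ f : B → B, IsUnaryPolynomial v f → (∃ x y, f x ≠ f y) →
      ∃ c, c ≠ z ∧ ({z, c} : Set B) ⊆ Set.range f := by
    rintro f hf ⟨x, y, hxy⟩
    have h0 := hf.map_absorbing hz hxy
    have h : f x ≠ z ∨ f y ≠ z := by
      by_contra! h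
      exact hxy (h.1.trans h.2.symm)
    rcases h with h | h
    · exact ⟨f x, h, Set.pair_subset ⟨z, h0⟩ ⟨x, rfl⟩⟩
    · exact ⟨f y, h, Set.pair_subset ⟨z, h0⟩ ⟨y, rfl⟩⟩
  constructor
  · rintro ⟨⟨f, hf, ⟨x, y, -, hxy⟩, rfl⟩, hmin⟩
    obtain ⟨c, hc, hsub⟩ := sub f hf ⟨x, y, hxy⟩
    exact ⟨c, hc, (hmin (mem c hc) hsub).antisymm hsub⟩
  · rintro ⟨c, hc, rfl⟩
    refine ⟨mem c hc, ?_⟩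
    rintro _ ⟨f, hf, ⟨x, y, -, hxy⟩, rfl⟩ hle
    obtain ⟨d, hd, hsub⟩ := sub f hf ⟨x, y, hxy⟩
    have hdc : d = c := by
      rcases hle (hsub (Set.mem_insert_of_mem z rfl)) with h | h
      · exact absurd h hd
      · exact h
    exact hdc ▸ hsub

theorem isTrace_iff (hz : ∀ t : Fin k → B, (∃ i, t i = z) → v t = z)
    (hret : ∀ c, c ≠ z → ∃ e, IsRetractionOntoPair v z c e) (N : Set B) :
    IsTrace v ⊥ ⊤ N ↔ ∃ c, c ≠ z ∧ N = {z, c} := by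
  constructor
  · rintro ⟨U, hU, ⟨a, rfl⟩, -⟩
    obtain ⟨c, hc, rfl⟩ := (isMinimalSet_iff hz hret U).1 hU
    exact ⟨c, hc, Set.ext fun x => and_iff_left trivial⟩
  · rintro ⟨c, hc, rfl⟩
    refine ⟨{z, c}, (isMinimalSet_iff hz hret _).2 ⟨c, hc, rfl⟩,
      ⟨z, Set.ext fun x => (and_iff_left trivial).symm⟩, c, by simp, z, by simp, hc⟩

theorem inducesSemilattice_pair (hv : IsWNU v)
    (hz : ∀ t : Fin k → B, (∃ i, t i = z) → v t = z) {c : B} (hc : c ≠ z) {e : B → B}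
    (he : IsRetractionOntoPair v z c e) : InducesSemilattice v ⊥ ({z, c} : Set B) := by
  classical
  have hzN : z ∈ ({z, c} : Set B) := by simp
  have hcN : c ∈ ({z, c} : Set B) := by simp
  have elim : ∀ x : ({z, c} : Set B), (x : B) = z ∨ (x : B) = c := fun x => x.2
  obtain ⟨hk, hidem, -⟩ := hv
  refine ⟨fun x => decide ((x : B) = c), ?_, ?_, ?_⟩
  · rintro (_ | _)
    · exact ⟨⟨z, hzN⟩, by simpa using hc.symm⟩
    · exact ⟨⟨c, hcN⟩, by simp⟩
  · intro x y
    change _ ↔ (x : B) = y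
    rcases elim x with hx | hx <;> rcases elim y with hy | hy <;> simp [hx, hy, hc, hc.symm]
  intro n g
  constructor
  · intro hg
    induction hg with
    | const b =>
      cases b
      · exact ⟨fun _ => z, .const z, fun _ => ⟨hzN, by simpa using hc.symm⟩⟩
      · exact ⟨fun _ => c, .const c, fun _ => ⟨hcN, by simp⟩⟩
    | proj i => exact ⟨fun x => x i, .proj i, fun x => ⟨(x i).2, rfl⟩⟩
    | app g _ ih =>
      choose p hp hpN using ih
      -- At arguments in {z, c}, `v` gives `c` if both are `c` (idempotence) and `z` otherwise
      -- (absorption). Applying `e` keeps all values in the pair even before this is known.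
      refine ⟨_, he.1.comp_polynomial ((hp 0).update (hp 1) ⟨0, by omega⟩), fun x => ⟨he.2.2.2 _, ?_⟩⟩
      obtain ⟨h0, e0⟩ := hpN 0 x
      obtain ⟨h1, e1⟩ := hpN 1 x
      simp only [boolMeet]
      rw [← e0, ← e1]
      rcases h0 with h0 | h0
      · rw [hz _ ⟨⟨1, by omega⟩, by simpa [Function.update] using h0⟩]
        simp [he.2.1, hc.symm, h0]
      rcases h1 with h1 | h1
      · rw [hz _ ⟨⟨0, by omega⟩, by simpa using h1⟩]
        simp [he.2.1, hc.symm, h1]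
      · rw [Set.mem_singleton_iff] at h0 h1
        simp [h0, h1, hidem, he.2.2.1]
  · rintro ⟨p, hp, hpg⟩
    obtain ⟨S, h₁, h₂⟩ := hp.exists_support hz
    let lift : (Fin n → Bool) → Fin n → ({z, c} : Set B) :=
      fun b i => if b i then ⟨c, hcN⟩ else ⟨z, hzN⟩
    have hlift : ∀ b, (fun i => decide ((lift b i : B) = c)) = b := by
      intro b
      funext i
      by_cases hb : b i = true <;> simp [lift, hb, hc.symm]
    have hgp : ∀ b, g b = decide (p (fun i => (lift b i : B)) = c) := by
      intro b
      obtain ⟨h, hb⟩ := hpg (lift b)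
      rw [hlift] at hb
      exact hb.symm
    -- The value at the all-true tuple decides: `g` is the meet over the support `S` if it is true,
    -- and constantly false otherwise.
    by_cases htop : g (fun _ => true) = true
    · convert isPolynomial_boolMeet_inf S using 2 with b
      by_cases hb : ∀ i ∈ S, b i = true
      · rw [decide_eq_true hb, ← htop, hgp, hgp, h₁ _ (fun i => (lift (fun _ => true) i : B))]
        intro i hi
        simp [lift, hb i hi]
      · rw [decide_eq_false hb, hgp]
        push Not at hb
        obtain ⟨i, hi, hbi⟩ := hb
        rw [h₂ _ ⟨i, hi, by simp [lift, hbi]⟩]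
        simpa using hc.symm
    · convert IsPolynomial.const (w := boolMeet) (n := n) false using 2 with b
      by_cases hb : ∀ i ∈ S, b i = true
      · rw [hgp, h₁ _ (fun i => (lift (fun _ => true) i : B)), ← hgp]
        · simpa using htop
        · intro i hi
          simp [lift, hb i hi]
      · rw [hgp]
        push Not at hb
        obtain ⟨i, hi, hbi⟩ := hb
        rw [h₂ _ ⟨i, hi, by simp [lift, hbi]⟩]
        simpa using hc.symm

/-- A simple wnu algebra with an absorbing element `z` such that every pair `{z, c}` is a polynomial
retract has type **5**. -/
theorem hasTypeFive_of_retractions (hv : IsWNU v) (hs : IsSimpleAlgebra v)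
    (hz : ∀ t : Fin k → B, (∃ i, t i = z) → v t = z)
    (hret : ∀ c, c ≠ z → ∃ e, IsRetractionOntoPair v z c e) {c : B} (hc : c ≠ z) :
    HasTypeFive v ⊥ ⊤ := by
  have : IsSimpleOrder (Congruence v) := hs
  refine ⟨bot_covBy_top, ⟨{z, c}, (isTrace_iff hz hret _).2 ⟨c, hc, rfl⟩⟩, fun N hN => ?_⟩
  obtain ⟨d, hd, rfl⟩ := (isTrace_iff hz hret N).1 hN
  obtain ⟨e, he⟩ := hret d hd
  exact inducesSemilattice_pair hv hz hd he

end Criterion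

/-- The extension of `A` by an absorbing element, a hub and arrows; `arrow a (some b)` leads from
`a` to `b`, and `arrow a none` from `a` to the hub. -/
inductive ArrowExtension (A : Type u) : Type u
  | base (a : A) : ArrowExtension A
  | hub : ArrowExtension A
  | zero : ArrowExtension A
  | arrow (a : A) (b : Option A) : ArrowExtension A

/-! ### The extension and its wnu operation -/

namespace ArrowExtension

variable {A : Type u}

instance [Finite A] : Finite (ArrowExtension A) := by
  let f : Option (Option A) ⊕ (A × Option A) → ArrowExtension A := fun s =>
    match s with
    | .inl none => zero
    | .inl (some none) => hub
    | .inl (some (some a)) => base a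
    | .inr (a, b) => arrow a b
  refine Finite.of_surjective f ?_
  rintro (a | _ | _ | ⟨a, b⟩)
  · exact ⟨.inl (some (some a)), rfl⟩
  · exact ⟨.inl (some none), rfl⟩
  · exact ⟨.inl none, rfl⟩
  · exact ⟨.inr (a, b), rfl⟩

/-- The element to which an arrow leads. -/
def target : Option A → ArrowExtension A
  | none => hub
  | some a => base a

open Classical in
/-- The commutative binary operation: an arrow moves its source to its target, the hub moves to any
arrow, and all other products of distinct elements are zero. -/
noncomputable def link : ArrowExtension A → ArrowExtension A → ArrowExtension A
  | base a, arrow c b => if a = c then target b else zero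
  | arrow c b, base a => if a = c then target b else zero
  | hub, arrow c b => arrow c b
  | arrow c b, hub => arrow c b
  | arrow c b, arrow a d => if c = a ∧ b = d then arrow c b else zero
  | hub, hub => hub
  | _, _ => zero

theorem link_comm (x y : ArrowExtension A) : link x y = link y x := by
  rcases x with a | _ | _ | ⟨a, b⟩ <;> rcases y with c | _ | _ | ⟨c, d⟩ <;> simp only [link]
  by_cases h : a = c ∧ b = d
  · obtain ⟨rfl, rfl⟩ := h
    rfl
  · rw [if_neg h, if_neg fun h' => h ⟨h'.1.symm, h'.2.symm⟩]

theorem link_zero (x : ArrowExtension A) : link x zero = zero := by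
  cases x <;> rfl

theorem link_self {x : ArrowExtension A} (hx : ∀ a, x ≠ base a) : link x x = x := by
  rcases x with a | _ | _ | ⟨a, b⟩
  · exact absurd rfl (hx a)
  · rfl
  · rfl
  · simp [link]

variable {k : ℕ} (w : (Fin k → A) → A)

open Classical in
/-- The extension of `w`: outside of `A`, it is `link x y` on tuples with entries `x` and `y`, and
zero on tuples with more than two distinct entries. -/
noncomputable def op (t : Fin k → ArrowExtension A) : ArrowExtension A :=
  if h : ∃ s : Fin k → A, t = fun i => base (s i) then base (w h.choose)
  else if h : ∃ q : ArrowExtension A × ArrowExtension A, Set.range t = {q.1, q.2} then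
    link h.choose.1 h.choose.2
  else zero

theorem op_base (s : Fin k → A) : op w (fun i => base (s i)) = base (w s) := by
  have h : ∃ s' : Fin k → A, (fun i => base (s i)) = fun i => base (s' i) := ⟨s, rfl⟩
  rw [op, dif_pos h]
  have h' := h.choose_spec
  congr 2
  funext i
  exact (base.inj (congrFun h' i)).symm

/-- The range determines the pair up to order, and `link` is commutative, so the choice made in `op`
is harmless. -/
theorem op_eq_link {t : Fin k → ArrowExtension A}
    (ht : ¬ ∃ s : Fin k → A, t = fun i => base (s i)) {x y : ArrowExtension A}
    (hxy : Set.range t = {x, y}) : op w t = link x y := by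
  have h : ∃ q : ArrowExtension A × ArrowExtension A, Set.range t = {q.1, q.2} := ⟨(x, y), hxy⟩
  rw [op, dif_neg ht, dif_pos h]
  have h' := hxy.symm.trans h.choose_spec
  rw [Set.pair_eq_pair_iff] at h'
  rcases h' with ⟨h₁, h₂⟩ | ⟨h₁, h₂⟩
  · rw [← h₁, ← h₂]
  · rw [← h₁, ← h₂, link_comm]

theorem op_eq_zero (t : Fin k → ArrowExtension A) (ht : ∃ i, t i = zero) : op w t = zero := by
  obtain ⟨i, hi⟩ := ht
  have hb : ¬ ∃ s : Fin k → A, t = fun i => base (s i) := by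
    rintro ⟨s, rfl⟩
    cases hi
  by_cases h : ∃ x y, Set.range t = {x, y}
  · obtain ⟨x, y, h⟩ := h
    rw [op_eq_link w hb h]
    have hmem : zero ∈ ({x, y} : Set (ArrowExtension A)) := h ▸ ⟨i, hi⟩
    rcases hmem with rfl | h
    · rw [link_comm, link_zero]
    · rw [← Set.mem_singleton_iff.1 h, link_zero]
  · rw [op, dif_neg hb, dif_neg]
    rintro ⟨q, hq⟩
    exact h ⟨q.1, q.2, hq⟩

theorem op_update (hk : 2 ≤ k) (i : Fin k) {x y : ArrowExtension A}
    (hxy : ∀ a b, x = base a → y ≠ base b) :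
    op w (Function.update (fun _ => x) i y) = link x y := by
  obtain ⟨j, hj⟩ : ∃ j : Fin k, j ≠ i := by
    have : Nontrivial (Fin k) := Fin.nontrivial_iff_two_le.2 hk
    exact exists_ne i
  have hi' : Function.update (fun _ => x) i y i = y := by simp
  have hj' : Function.update (fun _ => x) i y j = x := by simp [hj]
  refine op_eq_link w ?_ (Set.Subset.antisymm ?_ (Set.pair_subset ⟨j, hj'⟩ ⟨i, hi'⟩))
  · rintro ⟨s, hs⟩
    rw [hs] at hi' hj'
    exact hxy _ _ hj'.symm hi'.symm
  · rintro _ ⟨l, rfl⟩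
    by_cases hl : l = i
    · subst hl
      simp
    · simp [hl]

theorem op_update_base (i : Fin k) (a b : A) :
    op w (Function.update (fun _ => base a) i (base b)) =
      base (w (Function.update (fun _ => a) i b)) := by
  rw [← op_base]
  congr 1
  funext j
  by_cases hj : j = i
  · subst hj
    simp
  · simp [hj]

variable {w}

theorem isWNU_op (hw : IsWNU w) : IsWNU (op w) := by
  obtain ⟨hk, hidem, hwnu⟩ := hw
  refine ⟨hk, fun x => ?_, fun x y i j => ?_⟩
  · by_cases hx : ∃ a, x = base a
    · obtain ⟨a, rfl⟩ := hx
      rw [op_base, hidem]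
    · push Not at hx
      have h := op_update w hk ⟨0, by omega⟩ (x := x) (y := x) fun a _ h => absurd h (hx a)
      rw [link_self hx] at h
      simpa using h
  · by_cases h : ∃ a b, x = base a ∧ y = base b
    · obtain ⟨a, b, rfl, rfl⟩ := h
      rw [op_update_base, op_update_base, hwnu]
    · have h' : ∀ a b, x = base a → y ≠ base b := fun a b hx hy => h ⟨a, b, hx, hy⟩
      rw [op_update w hk i h', op_update w hk j h']

/-- The translation of `op w` by `u` in the first variable. -/
noncomputable def trans (w : (Fin k → A) → A) (hk : 2 ≤ k) (u x : ArrowExtension A) :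
    ArrowExtension A :=
  op w (Function.update (fun _ => u) ⟨0, by omega⟩ x)

/-! ### Translations, retractions and simplicity -/

theorem trans_arrow (hk : 2 ≤ k) (a : A) (b : Option A) (x : ArrowExtension A) :
    trans w hk (arrow a b) x = link (arrow a b) x :=
  op_update w hk _ fun _ _ h => by cases h

theorem trans_base (hk : 2 ≤ k) (a : A) {x : ArrowExtension A} (hx : ∀ b, x ≠ base b) :
    trans w hk (base a) x = link (base a) x :=
  op_update w hk _ fun _ b _ => hx b

theorem isUnaryPolynomial_trans (hk : 2 ≤ k) (u : ArrowExtension A) :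
    IsUnaryPolynomial (op w) (trans w hk u) :=
  isUnaryPolynomial_translation _ u

-- The route is `base a`, hub, `arrow a (some a)`, `base a`. The detour through the hub kills the
-- rest: the hub itself becomes `arrow a none`, whose product with the different arrow `arrow a
-- (some a)` is zero. No element of `A` reaches the last translation, where `w` would interfere.
open Classical in
theorem exists_indicator_base (w : (Fin k → A) → A) (hk : 2 ≤ k) (a : A) :
    IsUnaryPolynomial (op w) (fun x => if x = base a then base a else zero) := by
  have h := (isUnaryPolynomial_trans (w := w) hk (base a)).comp
    ((isUnaryPolynomial_trans (w := w) hk (arrow a (some a))).comp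
      (isUnaryPolynomial_trans (w := w) hk (arrow a none)))
  convert h using 2 with x
  rw [trans_arrow, trans_arrow]
  rcases x with c | _ | _ | ⟨c, d⟩
  · by_cases hc : c = a
    · subst hc
      rw [trans_base] <;> simp [link, target]
    · rw [trans_base] <;> simp [link, hc]
  · rw [trans_base] <;> simp [link]
  · rw [trans_base] <;> simp [link]
  · by_cases hc : a = c ∧ none = d
    · obtain ⟨rfl, rfl⟩ := hc
      rw [trans_base] <;> simp [link]
    · rw [trans_base] <;> simp [link, hc]

theorem exists_move_base (w : (Fin k → A) → A) (hk : 2 ≤ k) (a : A) (c : ArrowExtension A) :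
    ∃ f, IsUnaryPolynomial (op w) f ∧ f (base a) = c ∧ f zero = zero := by
  have hz : ∀ b, trans w hk (arrow a b) zero = zero := fun b => by rw [trans_arrow, link_zero]
  rcases c with b | _ | _ | ⟨c, d⟩
  · exact ⟨_, isUnaryPolynomial_trans hk (arrow a (some b)), by simp [trans_arrow, link, target],
      hz _⟩
  · exact ⟨_, isUnaryPolynomial_trans hk (arrow a none), by simp [trans_arrow, link, target],
      hz _⟩
  · exact ⟨fun _ => zero, .const zero, rfl, rfl⟩
  · exact ⟨_, (isUnaryPolynomial_trans hk (arrow c d)).comp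
      (isUnaryPolynomial_trans hk (arrow a none)), by simp [trans_arrow, link, target],
      by simp [trans_arrow, link]⟩

open Classical in
/-- Every map sending one element of `A` to a given element and all others to zero is
polynomial. -/
theorem exists_indicator (w : (Fin k → A) → A) (hk : 2 ≤ k) (a : A) (c : ArrowExtension A) :
    IsUnaryPolynomial (op w) (fun x => if x = base a then c else zero) := by
  obtain ⟨f, hf, hc, h0⟩ := exists_move_base w hk a c
  convert hf.comp (exists_indicator_base w hk a) using 2 with x
  split_ifs
  · exact hc.symm
  · exact h0.symm

theorem exists_hub_to_base [Nonempty A] (w : (Fin k → A) → A) (hk : 2 ≤ k) :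
    ∃ f a, IsUnaryPolynomial (op w) f ∧ f hub = base a ∧ f zero = zero := by
  obtain ⟨a⟩ := ‹Nonempty A›
  refine ⟨_, a, (isUnaryPolynomial_trans hk (base a)).comp
    (isUnaryPolynomial_trans hk (arrow a (some a))), ?_, ?_⟩
  · rw [trans_arrow, trans_base] <;> simp [link, target]
  · rw [trans_arrow, trans_base] <;> simp [link]

theorem exists_to_base [Nonempty A] (w : (Fin k → A) → A) (hk : 2 ≤ k) {c : ArrowExtension A}
    (hc : c ≠ zero) : ∃ f a, IsUnaryPolynomial (op w) f ∧ f c = base a ∧ f zero = zero := by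
  rcases c with b | _ | _ | ⟨c, d⟩
  · exact ⟨_, b, isUnaryPolynomial_id, rfl, rfl⟩
  · exact exists_hub_to_base w hk
  · exact absurd rfl hc
  · have h0 : trans w hk (base c) zero = zero := by rw [trans_base] <;> simp [link]
    have h1 : trans w hk (base c) (arrow c d) = target d := by rw [trans_base] <;> simp [link]
    cases d with
    | some d => exact ⟨_, d, isUnaryPolynomial_trans hk (base c), h1, h0⟩
    | none =>
      obtain ⟨f, a, hf, hh, hz⟩ := exists_hub_to_base w hk
      exact ⟨_, a, hf.comp (isUnaryPolynomial_trans hk (base c)), by rw [h1]; exact hh,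
        by rw [h0, hz]⟩

theorem exists_retraction [Nonempty A] (w : (Fin k → A) → A) (hk : 2 ≤ k)
    {c : ArrowExtension A} (hc : c ≠ zero) : ∃ e, IsRetractionOntoPair (op w) zero c e := by
  classical
  obtain ⟨f, a, hf, hfc, hf0⟩ := exists_to_base w hk hc
  refine ⟨_, (exists_indicator w hk a c).comp hf, by simp [hf0], by simp [hfc], fun x => ?_⟩
  by_cases h : f x = base a <;> simp [h]

/-- A congruence which relates an element of `A` to another element is full. -/
theorem congruence_eq_top_of_base (hk : 2 ≤ k) (θ : Congruence (op w)) {a : A}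
    {y : ArrowExtension A} (hy : y ≠ base a) (h : θ.1 (base a) y) : θ = ⊤ := by
  classical
  -- The indicator sends `base a` to `c` and `y` to zero.
  have h0 : ∀ c, θ.1 c zero := by
    intro c
    simpa [hy] using (exists_indicator w hk a c).congruence θ h
  refine Subtype.ext (Setoid.ext fun x y => ⟨fun _ => trivial, fun _ => ?_⟩)
  exact θ.1.trans (h0 x) (θ.1.symm (h0 y))

theorem congruence_eq_top_of_zero [Nonempty A] (hk : 2 ≤ k) (θ : Congruence (op w))
    {x : ArrowExtension A} (hx : x ≠ zero) (h : θ.1 x zero) : θ = ⊤ := by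
  obtain ⟨f, a, hf, hfx, hf0⟩ := exists_to_base w hk hx
  have h' := hf.congruence θ h
  rw [hfx, hf0] at h'
  exact congruence_eq_top_of_base hk θ (by simp) h'

/-- Translating by `base a` sends the arrow to its target but the hub to zero. Translating by the
arrow itself fixes it and kills every other arrow. -/
theorem congruence_eq_top_of_arrow [Nonempty A] (hk : 2 ≤ k) (θ : Congruence (op w))
    {a : A} {b : Option A} {y : ArrowExtension A} (hy : y ≠ arrow a b)
    (h : θ.1 (arrow a b) y) : θ = ⊤ := by
  rcases y with c | _ | _ | ⟨c, d⟩
  · exact congruence_eq_top_of_base hk θ (by simp) (θ.1.symm h)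
  · have h' := (isUnaryPolynomial_trans hk (base a)).congruence θ h
    rw [trans_base hk a (by simp), trans_base hk a (by simp)] at h'
    refine congruence_eq_top_of_zero hk θ (x := target b) (by cases b <;> simp [target]) ?_
    simpa [link] using h'
  · exact congruence_eq_top_of_zero hk θ (by simp) h
  · have h' := (isUnaryPolynomial_trans hk (arrow a b)).congruence θ h
    rw [trans_arrow, trans_arrow] at h'
    refine congruence_eq_top_of_zero hk θ (x := arrow a b) (by simp) ?_
    have hne : ¬ (a = c ∧ b = d) := by
      rintro ⟨rfl, rfl⟩
      exact hy rfl
    simpa [link, hne] using h'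

theorem isSimpleAlgebra_op [Nonempty A] (w : (Fin k → A) → A) (hk : 2 ≤ k) :
    IsSimpleAlgebra (op w) := by
  have hnt : (⊥ : Congruence (op w)) ≠ ⊤ := by
    intro h
    have h' : (⊥ : Congruence (op w)).1 hub zero := by
      rw [h]
      trivial
    have h'' : (hub : ArrowExtension A) = zero := h'
    cases h''
  refine { exists_pair_ne := ⟨_, _, hnt⟩, eq_bot_or_eq_top := fun θ => ?_ }
  by_cases hθ : ∀ x y, θ.1 x y → x = y
  · exact .inl (Subtype.ext (Setoid.ext fun x y => ⟨hθ x y, fun h => h ▸ θ.1.refl x⟩))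
  · right
    push Not at hθ
    obtain ⟨x, y, h, hxy⟩ := hθ
    rcases x with a | _ | _ | ⟨a, b⟩
    · exact congruence_eq_top_of_base hk θ hxy.symm h
    · rcases y with c | _ | _ | ⟨c, d⟩
      · exact congruence_eq_top_of_base hk θ hxy (θ.1.symm h)
      · exact absurd rfl hxy
      · exact congruence_eq_top_of_zero hk θ hxy h
      · exact congruence_eq_top_of_arrow hk θ hxy (θ.1.symm h)
    · exact congruence_eq_top_of_zero hk θ hxy.symm (θ.1.symm h)
    · exact congruence_eq_top_of_arrow hk θ hxy.symm h

end ArrowExtension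

theorem mainTheorem10 {A : Type u} [Finite A] [Nonempty A] {k : ℕ} (w : (Fin k → A) → A)
    (hw : IsWNU w) :
    ∃ (B : Type u) (_ : Finite B) (v : (Fin k → B) → B),
      IsWNU v ∧ IsSimpleAlgebra v ∧ HasTypeFive v ⊥ ⊤ ∧
        ∃ ι : A → B, Function.Injective ι ∧
          ∀ x : Fin k → A, ι (w x) = v (fun i => ι (x i)) := by
  have hs := ArrowExtension.isSimpleAlgebra_op w hw.1
  refine ⟨ArrowExtension A, inferInstance, ArrowExtension.op w, ArrowExtension.isWNU_op hw, hs, ?_,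
    ArrowExtension.base, fun _ _ h => ArrowExtension.base.inj h,
    fun x => (ArrowExtension.op_base w x).symm⟩
  exact hasTypeFive_of_retractions (ArrowExtension.isWNU_op hw) hs (ArrowExtension.op_eq_zero w)
    (fun _ hc => ArrowExtension.exists_retraction w hw.1 hc) (c := ArrowExtension.hub) (by simp)
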